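/- Let $T$ be a complete first-order theory in an arbitrary language $L$, and let $\mathfrak{C}$ be a monster model of $T$. "Formula" means $L$-formula without parameters, "definable" means definable with parameters, and tuples of variables are finite. A family $\mathcal{A}$ of subsets of a set $X$ is \emph{independent} if for every $s:\mathcal{A}\to\{0,1\}$ the set $\bigcap_{B\in\mathcal{A}}B^{s(B)}$ is nonempty, where $B^1=B$ and $B^0=X\setminus B$. The \emph{independence dimension} of $\mathcal{A}$ is the largest $N<\omega$ (if it exists) such that some independent $\mathcal{B}\subseteq\mathcal{A}$ has exactly $N$ members. The independence dimension of a partitioned formula $\varphi(\overline{x};\overline{y})$ is that of the family of all sets $\varphi(\mathfrak{C};\overline{b})=\{\overline{a} : \mathfrak{C}\models\varphi(\overline{a};\overline{b})\}$, where $\overline{b}$ ranges over the tuples from $\mathfrak{C}$ of the length of $\overline{y}$. $T$ is \emph{weakly VC-minimal} if for every formula $\varphi(x;\overline{y})$ with $x$ a single variable and every $\overline{b}$ from $\mathfrak{C}$, there are finitely many formulas $\psi_i(x;\overline{z}_i)$, each of independence dimension $\le 1$, and tuples $\overline{c}_i$ from $\mathfrak{C}$ such that $\varphi(\mathfrak{C};\overline{b})$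 is a Boolean combination of the sets $\psi_i(\mathfrak{C};\overline{c}_i)$. A formula $\varphi(\overline{x};\overline{y})$ is \emph{unstable} if it has the order property: there are tuples $\overline{a}_i,\overline{b}_j$ from $\mathfrak{C}$ ($i,j<\omega$) such that $\varphi(\overline{a}_i;\overline{b}_j)$ holds if and only if $i<j$; otherwise it is \emph{stable}. $T$ is \emph{stable} if all formulas $\varphi(\overline{x};\overline{y})$ are stable. A formula $\varphi(\overline{x};\overline{y})$ has the \emph{strict order property} if there are $\overline{b}_i$ from $\mathfrak{C}$ ($i<\omega$) such that $\varphi(\mathfrak{C};\overline{b}_i)\subsetneq\varphi(\mathfrak{C};\overline{b}_{j})$ whenever $i<j$. $T$ \emph{interprets an infinite linear order} if there are an infinite linear order $(I,\le)$, a definable set $D\subseteq\mathfrak{C}^k$ for some $k$, and a surjection $f:D\to I$ such that $\{(\overline{a},\overline{b})\in D^2 : f(\overline{a})=f(\overline{b})\}$ and $\{(\overline{a},\overline{b})\in D^2 : f(\overline{a})\le f(\overline{b})\}$ are definable. For a formula $\varphi(\overline{x};\overline{y})$ write $\overline{b}\le_\varphi\overline{c}$ if $\varphi(\mathfrak{C};\overline{b})\subseteq\varphi(\mathfrak{C};\overline{c})$,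 and $\overline{b}\equiv_\varphi\overline{c}$ if $\overline{b}\le_\varphi\overline{c}$ and $\overline{c}\le_\varphi\overline{b}$. \textbf{Theorem.} (1) If $T$ is weakly VC-minimal, then $T$ is stable or $T$ interprets an infinite linear order. (2) If a formula $\varphi(\overline{x};\overline{y})$ has independence dimension $\le 1$ and is unstable, then it has the strict order property, and moreover there is a definable set $D$ of tuples of the length of $\overline{y}$ such that $\le_\varphi$ induces an infinite linear ordering on $D/{\equiv_\varphi}$. -/

import Mathlib

universe u v w

namespace WeakVC

/-! ### Independence dimension of a family of sets -/

section Families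

variable {X : Type w}

/-- A family `𝒜` of subsets of `X` is independent with respect to `X` if for every
`s : 𝒜 → {0, 1}` the intersection of the sets `B ^ s(B)` is nonempty, where `B ^ 1 = B` and
`B ^ 0 = X \ B`. -/
def Independent (𝒜 : Set (Set X)) : Prop :=
  ∀ s : 𝒜 → Bool, (⋂ B : 𝒜, bif s B then (B : Set X) else (B : Set X)ᶜ).Nonempty

/-- `𝒜` has independence dimension `N`: the number `N` is maximal such that some subfamily of
`𝒜` with exactly `N` members is independent with respect to `X`. -/
def FamilyHasIndepDim (𝒜 : Set (Set X)) (N : ℕ) : Prop :=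
  IsGreatest {k : ℕ | ∃ ℬ : Finset (Set X), (ℬ : Set (Set X)) ⊆ 𝒜 ∧ ℬ.card = k ∧
    Independent (ℬ : Set (Set X))} N

end Families

/-! ### Partitioned formulas in a structure

A partitioned formula `φ(x₁,…,xₘ; y₁,…,yₙ)` is an element of `L.Formula (Fin m ⊕ Fin n)`. -/

section Structures

variable {L : FirstOrder.Language.{u, v}} {m n : ℕ} (M : Type w) [L.Structure M]

/-- The set `φ(M; b) = {a ∈ Mᵐ | M ⊨ φ(a; b)}`. -/
def inst (φ : L.Formula (Fin m ⊕ Fin n)) (b : Fin n → M) : Set (Fin m → M) :=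
  {a | φ.Realize (Sum.elim a b)}

/-- `b ≤_φ c` means `M ⊨ ∀ x (φ(x; b) → φ(x; c))`. -/
def ParamLE (φ : L.Formula (Fin m ⊕ Fin n)) (b c : Fin n → M) : Prop :=
  ∀ a : Fin m → M, φ.Realize (Sum.elim a b) → φ.Realize (Sum.elim a c)

/-- The equivalence relation `≡_φ` on `D ⊆ Mⁿ`: `b ≤_φ c` and `c ≤_φ b`. -/
def paramSetoid (φ : L.Formula (Fin m ⊕ Fin n)) (D : Set (Fin n → M)) : Setoid D where
  r b c := ParamLE M φ b c ∧ ParamLE M φ c b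
  iseqv :=
    { refl := fun _ => ⟨fun _ h => h, fun _ h => h⟩
      symm := fun h => ⟨h.2, h.1⟩
      trans := fun h h' => ⟨fun a ha => h'.1 a (h.1 a ha), fun a ha => h.2 a (h'.2 a ha)⟩ }

/-- `≤_φ` induces an infinite linear ordering on `D / ≡_φ`. -/
def InducesInfiniteLinearOrder (φ : L.Formula (Fin m ⊕ Fin n)) (D : Set (Fin n → M)) : Prop :=
  Infinite (Quotient (paramSetoid M φ D)) ∧
    ∃ lo : LinearOrder (Quotient (paramSetoid M φ D)),
      ∀ b c : D, lo.le (Quotient.mk _ b) (Quotient.mk _ c) ↔ ParamLE M φ b c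

/-- The `L`-structure `M` interprets (with parameters) the linear order `I`: there are a definable
set `D ⊆ Mᵏ` and a surjection `f : D → I` such that the preimages under `f` of the relations
`=` and `≤` of `I` are definable subsets of `Mᵏ × Mᵏ`. -/
def InterpretsLinearOrder (L : FirstOrder.Language.{u, v}) (M : Type w) [L.Structure M]
    (I : Type w) [LinearOrder I] : Prop :=
  ∃ (k : ℕ) (D : Set (Fin k → M)) (f : D → I),
    (Set.univ : Set M).Definable L D ∧
    Function.Surjective f ∧
    (Set.univ : Set M).Definable L
      {p : Fin k ⊕ Fin k → M | ∃ (h₁ : p ∘ Sum.inl ∈ D) (h₂ : p ∘ Sum.inr ∈ D),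
        f ⟨p ∘ Sum.inl, h₁⟩ = f ⟨p ∘ Sum.inr, h₂⟩} ∧
    (Set.univ : Set M).Definable L
      {p : Fin k ⊕ Fin k → M | ∃ (h₁ : p ∘ Sum.inl ∈ D) (h₂ : p ∘ Sum.inr ∈ D),
        f ⟨p ∘ Sum.inl, h₁⟩ ≤ f ⟨p ∘ Sum.inr, h₂⟩}

end Structures

/-! ### Notions for a theory

The theories considered are complete. In place of a monster model we quantify over the models of
`T` in the universe of the language (every type over the empty set in countably many variables is
realized in one of them): the monster model contains a given configuration if and only if some
model does, and a property of all tuples of the monster model is required of all tuples of all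
models. -/

section Theories

variable {L : FirstOrder.Language.{u, v}} (T : L.Theory) {m n : ℕ}

/-- The partitioned formula `φ` has independence dimension `N`. -/
def HasIndepDim (φ : L.Formula (Fin m ⊕ Fin n)) (N : ℕ) : Prop :=
  ∀ M : FirstOrder.Language.Theory.ModelType.{u, v, max u v} T,
    FamilyHasIndepDim (Set.range fun b : Fin n → M => inst M φ b) N

/-- The partitioned formula `φ` has independence dimension at most `k`. -/
def IndepDimLE (φ : L.Formula (Fin m ⊕ Fin n)) (k : ℕ) : Prop :=
  ∃ N ≤ k, HasIndepDim T φ N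

/-- `φ(x; y)` has the order property: there are `aᵢ`, `bⱼ` (`i, j < ω`) such that `φ(aᵢ; bⱼ)`
holds if and only if `i < j`. -/
def HasOrderProperty (φ : L.Formula (Fin m ⊕ Fin n)) : Prop :=
  ∃ (M : FirstOrder.Language.Theory.ModelType.{u, v, max u v} T) (a : ℕ → Fin m → M) (b : ℕ → Fin n → M),
    ∀ i j : ℕ, φ.Realize (Sum.elim (a i) (b j)) ↔ i < j

/-- A formula is stable if it does not have the order property. -/
def IsStableFormula (φ : L.Formula (Fin m ⊕ Fin n)) : Prop :=
  ¬ HasOrderProperty T φ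

/-- A theory is stable if all partitioned formulas (in tuples of all lengths) are stable. -/
def IsStable : Prop :=
  ∀ (m n : ℕ) (φ : L.Formula (Fin m ⊕ Fin n)), IsStableFormula T φ

/-- `φ(x; y)` has the strict order property: there are `bᵢ` (`i < ω`) such that the sets
`φ(M; bᵢ)` are strictly increasing. -/
def HasStrictOrderProperty (φ : L.Formula (Fin m ⊕ Fin n)) : Prop :=
  ∃ (M : FirstOrder.Language.Theory.ModelType.{u, v, max u v} T) (b : ℕ → Fin n → M),
    StrictMono fun i => inst M φ (b i)

/-- `T` is weakly VC-minimal: every instance `φ(x; b)` of a formula in the single variable `x` is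
a Boolean combination of finitely many instances `ψᵢ(x; cᵢ)`, where each `ψᵢ` has independence
dimension at most `1`. -/
def IsWeaklyVCMinimal : Prop :=
  ∀ (n : ℕ) (φ : L.Formula (Fin 1 ⊕ Fin n))
    (M : FirstOrder.Language.Theory.ModelType.{u, v, max u v} T) (b : Fin n → M),
    ∃ (k : ℕ) (l : Fin k → ℕ) (ψ : (i : Fin k) → L.Formula (Fin 1 ⊕ Fin (l i)))
      (c : (i : Fin k) → Fin (l i) → M),
      (∀ i, IndepDimLE T (ψ i) 1) ∧
      inst M φ b ∈ BooleanSubalgebra.closure (Set.range fun i => inst M (ψ i) (c i))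

/-- `T` interprets an infinite linear order. -/
def InterpretsInfiniteLinearOrder : Prop :=
  ∃ (M : FirstOrder.Language.Theory.ModelType.{u, v, max u v} T) (I : Type (max u v)) (_ : LinearOrder I),
    Infinite I ∧ InterpretsLinearOrder L M I

end Theories

end WeakVC

namespace WeakVC

/-! ### Ramsey's theorem and finite ladders -/

section Combinatorics

open Filter

/-! For (2), take a ladder indexed by ω + 1. Its first point lies in every instance of positive
index and its last point in none. Two incomparable instances that contain the one point and omit the
other would be an independent pair, so inclusion is total on the definable set of such parameters
(`IndepDimLE.paramLE_total`), and the ladder gives an infinite strict chain there.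

For (1), it suffices to find an unstable formula of independence dimension at most one. Instability
shows up in a single variable (`isStable_of_forall_one_variable`): if one-variable formulas are
stable, then after Ramsey the first coordinate of a ladder point cannot detect its own place, so one
value of it serves all cuts and can become a parameter (`HasOrderProperty.moveVar`). Given an
unstable φ(x; y), compactness yields one list of formulas of dimension at most one that determines
φ(x; b) for infinitely many ladder parameters b; Ramsey then passes the order to a member of the
list (`exists_hasLadder_of_determines`). -/

theorem exists_strictMono_mem_of_mem_hyperfilter {k : ℕ} (S : (Fin k → ℕ) → Set ℕ)
    (hS : ∀ e, S e ∈ hyperfilter ℕ) :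
    ∃ g : ℕ → ℕ, StrictMono g ∧ ∀ n (e : Fin k → ℕ), (∀ i, e i < n) → g n ∈ S (g ∘ e) := by
  -- Finitely many earlier choices form finitely many tuples, so only finitely many
  -- ultrafilter-large conditions must be met at once, and `g` can be built greedily.
  have key : ∀ s : Finset ℕ, ∃ x, (∀ y ∈ s, y < x) ∧
      ∀ e : Fin k → ℕ, (∀ i, e i ∈ s) → x ∈ S e := by
    intro s
    have h₁ : ∀ᶠ x in (hyperfilter ℕ : Filter ℕ), ∀ y ∈ s, y < x := by
      refine (Finset.eventually_all s).2 fun y _ => ?_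
      exact (Nat.hyperfilter_le_atTop) (eventually_gt_atTop y)
    have h₂ : ∀ᶠ x in (hyperfilter ℕ : Filter ℕ), ∀ e : Fin k → s, x ∈ S (fun i => e i) :=
      eventually_all.2 fun e => hS _
    obtain ⟨x, hx₁, hx₂⟩ := (h₁.and h₂).exists
    exact ⟨x, hx₁, fun e he => hx₂ fun i => ⟨e i, he i⟩⟩
  choose pick hlt hmem using key
  let G : ℕ → Finset ℕ := fun n => Nat.rec ∅ (fun _ s => insert (pick s) s) n
  have hG : ∀ n, G (n + 1) = insert (pick (G n)) (G n) := fun n => rfl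
  have hmono : Monotone G := monotone_nat_of_le_succ fun n => by
    rw [hG]; exact Finset.subset_insert _ _
  have hin : ∀ i n, i < n → pick (G i) ∈ G n := fun i n h =>
    hmono h (by rw [hG]; exact Finset.mem_insert_self _ _)
  exact ⟨fun n => pick (G n), fun i j h => hlt _ _ (hin i j h),
    fun n e he => hmem _ _ fun i => hin _ _ (he i)⟩

/-- Ramsey's theorem for colourings of the increasing `k`-tuples of natural numbers. -/
theorem exists_strictMono_homogeneous {C : Type*} [Finite C] (k : ℕ) (f : (Fin k → ℕ) → C) :
    ∃ g : ℕ → ℕ, StrictMono g ∧ ∃ c, ∀ e : Fin k → ℕ, StrictMono e → f (g ∘ e) = c := by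
  induction k with
  | zero => exact ⟨id, strictMono_id, f Fin.elim0, fun e _ => congrArg f (Subsingleton.elim _ _)⟩
  | succ k ih =>
    -- The limit colour in the last entry is a colouring of `k`-tuples; along `g` it is already
    -- attained.
    have hlim : ∀ e : Fin k → ℕ, ∃ c, {x | f (Fin.snoc e x) = c} ∈ hyperfilter ℕ := by
      intro e
      by_contra! h
      have h' : ∀ᶠ x in (hyperfilter ℕ : Filter ℕ), ∀ c, f (Fin.snoc e x) ≠ c :=
        eventually_all.2 fun c => Ultrafilter.compl_mem_iff_notMem.2 (h c)
      obtain ⟨x, hx⟩ := h'.exists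
      exact hx _ rfl
    choose f' hf' using hlim
    obtain ⟨g, hg, hgS⟩ := exists_strictMono_mem_of_mem_hyperfilter _ hf'
    obtain ⟨g', hg', c, hc⟩ := ih fun e => f' (g ∘ e)
    refine ⟨g ∘ g', hg.comp hg', c, fun e he => ?_⟩
    have h₁ := hgS (g' (e (Fin.last k))) (g' ∘ e ∘ Fin.castSucc)
      fun i => hg' (he (Fin.castSucc_lt_last i))
    have h₂ := hc (e ∘ Fin.castSucc) (he.comp Fin.strictMono_castSucc)
    rw [← h₂, ← Set.mem_ofPred.1 h₁]
    congr 1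
    ext i
    refine Fin.lastCases ?_ (fun i => ?_) i <;> simp

variable {α β : Type*}

/-- `R` has a ladder of length `K`. -/
def HasLadder (R : α → β → Prop) (K : ℕ) : Prop :=
  ∃ (a : ℕ → α) (b : ℕ → β), ∀ i < K, ∀ j < K, R (a i) (b j) ↔ i < j

/-- Giving rows and columns opposite parities avoids the diagonal, where nothing is known. If `c`
fails, the order is reversed. -/
theorem hasLadder_of_cut {R : α → β → Prop} {K : ℕ} {u : ℕ → α} {v : ℕ → β} {c c' : Prop}
    (hc : ¬(c ↔ c')) (h₁ : ∀ i j, i < j → j < 2 * K + 2 → (R (u i) (v j) ↔ c))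
    (h₂ : ∀ i j, j < i → i < 2 * K + 2 → (R (u i) (v j) ↔ c')) : HasLadder R K := by
  by_cases h : c
  · have h' : ¬c' := fun h' => hc (iff_of_true h h')
    refine ⟨fun i => u (2 * i + 1), fun j => v (2 * j), fun i hi j hj => ?_⟩
    rcases lt_or_ge i j with hij | hij
    · exact iff_of_true ((h₁ _ _ (by omega) (by omega)).2 h) hij
    · exact iff_of_false (fun hR => h' ((h₂ _ _ (by omega) (by omega)).1 hR)) (by omega)
  · have h' : c' := by tauto
    refine ⟨fun i => u (2 * (K - i)), fun j => v (2 * (K - j) + 1), fun i hi j hj => ?_⟩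
    rcases lt_or_ge i j with hij | hij
    · exact iff_of_true ((h₂ _ _ (by omega) (by omega)).2 h') hij
    · exact iff_of_false (fun hR => h ((h₁ _ _ (by omega) (by omega)).1 hR)) (by omega)

/-- If `i < j` is determined, for each `j`, by the values `Q l (a i) (c l j)` for `l` in a finite
type, then some `Q l` has ladders of all lengths. -/
theorem exists_hasLadder_of_determines {ι : Type} [Finite ι] {γ : ι → Type*}
    (Q : (l : ι) → α → γ l → Prop) (a : ℕ → α) (c : (l : ι) → ℕ → γ l)
    (h : ∀ i i' j, (∀ l, Q l (a i) (c l j) ↔ Q l (a i') (c l j)) → (i < j ↔ i' < j)) :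
    ∃ l, ∀ K, HasLadder (Q l) K := by
  obtain ⟨g, hg, C, hC⟩ := exists_strictMono_homogeneous 2 fun (e : Fin 2 → ℕ) (l : ι) =>
    (Q l (a (e 0)) (c l (e 1)), Q l (a (e 1)) (c l (e 0)))
  have hC' : ∀ i j, i < j → ∀ l, (Q l (a (g i)) (c l (g j)) ↔ (C l).1) ∧
      (Q l (a (g j)) (c l (g i)) ↔ (C l).2) := by
    intro i j hij l
    have h₀ := congrFun (hC ![i, j] (by
      intro x y; fin_cases x <;> fin_cases y <;> simp [hij])) l
    rw [← h₀]
    simp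
  have hl : ∃ l, ¬((C l).1 ↔ (C l).2) := by
    by_contra! hl
    -- If no `Q l` separates the two sides of the diagonal, then `g 0` and `g 2` look alike from `g
    -- 1`, though only one of them precedes it.
    have := h (g 0) (g 2) (g 1) fun l => by
      rw [(hC' 0 1 (by omega) l).1, (hC' 1 2 (by omega) l).2, hl l]
    have h01 := hg (show 0 < 1 by omega)
    have h12 := hg (show 1 < 2 by omega)
    omega
  obtain ⟨l, hl⟩ := hl
  exact ⟨l, fun K => hasLadder_of_cut (u := fun i => a (g i)) (v := fun j => c l (g j)) hl
    (fun i j hij _ => (hC' i j hij l).1) fun i j hij _ => (hC' j i hij l).2⟩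

/-- Places `s` and `s + 1` range freely over a window while the other places stay fixed; this lets
the element pass one parameter. -/
theorem strictMono_splice {N : ℕ} (s : Fin N) {p q B : ℕ} (hp : N ≤ p) (hpq : p < q) (hq : q < B) :
    StrictMono fun k : Fin (N + 1) => if (k : ℕ) < s then (k : ℕ) else
      if (k : ℕ) = s then p else if (k : ℕ) = s + 1 then q else B + k := by
  intro x y hxy
  have : (x : ℕ) < y := hxy
  have := s.2
  dsimp only
  split_ifs <;> omega

/-- If `Θ n` has ladders of bounded length only and holds at those increasing configurations in
which the element stands at place `n` among the parameters, then all `Θ n` hold at a common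
point. -/
theorem exists_forall_of_forall_diagonal {N : ℕ} (Θ : Fin (N + 1) → α → (Fin N → β) → Prop)
    (hΘ : ∀ n, ∃ K, ¬HasLadder (Θ n) K) (a : ℕ → α) (b : ℕ → β)
    (h : ∀ (n : Fin (N + 1)) (e : Fin (N + 1) → ℕ), StrictMono e →
      Θ n (a (e n)) fun k => b (e (n.succAbove k))) :
    ∃ x y, ∀ n, Θ n x y := by
  obtain ⟨g, hg, C, hC⟩ := exists_strictMono_homogeneous (N + 1)
    fun (e : Fin (N + 1) → ℕ) (n s : Fin (N + 1)) => Θ n (a (e s)) fun k => b (e (s.succAbove k))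
  have hC' : ∀ (n s : Fin (N + 1)) (e : Fin (N + 1) → ℕ), StrictMono e →
      ((Θ n (a (g (e s))) fun k => b (g (e (s.succAbove k)))) ↔ C n s) := fun n s e he => by
    rw [← hC e he]; rfl
  -- By homogeneity, the truth of `Θ n` depends only on the place of the element. A change on
  -- passing the `s`-th parameter would produce long ladders.
  have hstep : ∀ (n : Fin (N + 1)) (s : Fin N), C n s.castSucc ↔ C n s.succ := by
    intro n s
    by_contra hne
    obtain ⟨K, hK⟩ := hΘ n
    -- Only the element and the `s`-th parameter vary. A later `k`-th parameter stands at place `k +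
    -- 1`, since the element takes up a place before it.
    refine hK (hasLadder_of_cut (u := fun i => a (g (N + i)))
      (v := fun j k => b (g (if (k : ℕ) < s then (k : ℕ) else if (k : ℕ) = s then N + j else
        N + (2 * K + 2) + (k + 1)))) hne ?_ ?_)
    · intro i j hij hj
      rw [← hC' n s.castSucc _ (strictMono_splice s (p := N + i) (q := N + j)
        (B := N + (2 * K + 2)) (by omega) (by omega) (by omega))]
      rw [iff_iff_eq]
      congr 2
      · simp
      · ext k
        congr 2
        rcases lt_or_ge (k : ℕ) s with hk | hk
        · rw [Fin.succAbove_of_castSucc_lt _ _ (Fin.lt_def.2 (by simpa using hk))]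
          simp [hk]
        · rw [Fin.succAbove_of_le_castSucc _ _ (Fin.le_def.2 (by simpa using hk))]
          simp only [Fin.val_succ]
          split_ifs <;> omega
    · intro i j hij hi
      rw [← hC' n s.succ _ (strictMono_splice s (p := N + j) (q := N + i)
        (B := N + (2 * K + 2)) (by omega) (by omega) (by omega))]
      rw [iff_iff_eq]
      congr 2
      · simp
      · ext k
        congr 2
        rcases le_or_gt (k : ℕ) s with hk | hk
        · rw [Fin.succAbove_of_castSucc_lt _ _ (Fin.lt_def.2 (by simp; omega))]
          simp only [Fin.val_castSucc]
          split_ifs <;> omega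
        · rw [Fin.succAbove_of_le_castSucc _ _ (Fin.le_def.2 (by simp; omega))]
          simp only [Fin.val_succ]
          split_ifs <;> omega
  have hconst : ∀ n s, C n s ↔ C n 0 := fun n s => by
    induction s using Fin.induction with
    | zero => rfl
    | succ s ih => rw [← hstep, ih]
  have hid : StrictMono fun k : Fin (N + 1) => (k : ℕ) := Fin.val_strictMono
  -- Each `Θ n` holds with the element at place `n`, hence at place `0`, which is common to all `n`.
  refine ⟨_, _, fun n => (hC' n 0 _ hid).2 ((hconst n n).1 ((hC' n n _ hid).1 ?_))⟩
  exact h n (fun k => g k) (hg.comp hid)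

end Combinatorics

/-! ### Compactness and the order property -/

section Compactness

open FirstOrder FirstOrder.Language

variable {L : FirstOrder.Language.{u, v}} {T : L.Theory}

theorem exists_realize_of_finitely_realized {α : Type} (Γ : Set (L.Formula α))
    (h : ∀ Γ₀ : Finset (L.Formula α), (Γ₀ : Set (L.Formula α)) ⊆ Γ →
      ∃ (M : Theory.ModelType.{u, v, max u v} T) (v : α → M), ∀ φ ∈ Γ₀, φ.Realize v) :
    ∃ (M : Theory.ModelType.{u, v, max u v} T) (v : α → M), ∀ φ ∈ Γ, φ.Realize v := by
  classical
  let T' : L[[α]].Theory := (L.lhomWithConstants α).onTheory T ∪ Formula.equivSentence '' Γ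
  have hT' : T'.IsSatisfiable := by
    rw [Theory.isSatisfiable_iff_isFinitelySatisfiable]
    intro T₀ hT₀
    obtain ⟨M, v, hv⟩ := h ((T₀.image Formula.equivSentence.symm).filter (· ∈ Γ))
      fun φ hφ => (Finset.mem_filter.1 hφ).2
    let _ := constantsOn.structure v
    have : M ⊨ (T₀ : L[[α]].Theory) := by
      refine (Theory.model_iff _).2 fun σ hσ => ?_
      rcases hT₀ hσ with hσ' | ⟨φ, hφ, rfl⟩
      · exact ((L.lhomWithConstants α).onTheory_model T).2 M.is_model |>.realize_of_mem σ hσ'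
      · rw [Formula.realize_equivSentence]
        refine hv φ (Finset.mem_filter.2 ⟨Finset.mem_image.2 ⟨_, hσ, ?_⟩, hφ⟩)
        simp
    exact Theory.Model.isSatisfiable M
  obtain ⟨M⟩ := hT'
  have hM := (Theory.model_iff _).1 M.is_model
  have hM₁ : M ⊨ (L.lhomWithConstants α).onTheory T :=
    (Theory.model_iff _).2 fun σ hσ => hM σ (Or.inl hσ)
  let M' : Theory.ModelType.{u, v, max u v} T :=
    (Theory.ModelType.of ((L.lhomWithConstants α).onTheory T) M).reduct (L.lhomWithConstants α)
  refine ⟨M', fun a => (L.con a : M), fun φ hφ => ?_⟩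
  let _ : L.Structure M := (L.lhomWithConstants α).reduct M
  have : (L.lhomWithConstants α).IsExpansionOn M := LHom.isExpansionOn_reduct _ _
  exact (Formula.realize_equivSentence M φ).1 (hM _ (Or.inr ⟨φ, hφ, rfl⟩))

variable (T) in
/-- Models of `T` contain arbitrarily long finite ladders for `φ`. -/
def HasLadders {α β : Type} (φ : L.Formula (α ⊕ β)) : Prop :=
  ∀ K, ∃ M : Theory.ModelType.{u, v, max u v} T,
    HasLadder (fun (a : α → M) (b : β → M) => φ.Realize (Sum.elim a b)) K

theorem HasOrderProperty.hasLadders {m n : ℕ} {φ : L.Formula (Fin m ⊕ Fin n)}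
    (h : HasOrderProperty T φ) : HasLadders T φ := by
  obtain ⟨M, a, b, hab⟩ := h
  exact fun K => ⟨M, a, b, fun i _ j _ => hab i j⟩

theorem HasLadders.exists_ladder {α β : Type} {φ : L.Formula (α ⊕ β)} (h : HasLadders T φ)
    (I : Type) [LinearOrder I] :
    ∃ (M : Theory.ModelType.{u, v, max u v} T) (a : I → α → M) (b : I → β → M),
      ∀ i j, φ.Realize (Sum.elim (a i) (b j)) ↔ i < j := by
  classical
  let γ : I × I → L.Formula (I × α ⊕ I × β) := fun p =>
    let φ' := φ.relabel (Sum.map (Prod.mk p.1) (Prod.mk p.2))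
    if p.1 < p.2 then φ' else ∼φ'
  have hγ : ∀ (M : Theory.ModelType.{u, v, max u v} T) (v : I × α ⊕ I × β → M) (p : I × I),
      (γ p).Realize v ↔ (φ.Realize (Sum.elim (fun x => v (Sum.inl (p.1, x)))
        fun y => v (Sum.inr (p.2, y))) ↔ p.1 < p.2) := by
    intro M v p
    have : v ∘ Sum.map (Prod.mk p.1) (Prod.mk p.2) = Sum.elim (fun x => v (Sum.inl (p.1, x)))
        fun y => v (Sum.inr (p.2, y)) := by
      ext z; cases z <;> rfl
    dsimp only [γ]
    split_ifs with hp
    · simp [Formula.realize_relabel, this, hp]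
    · simp [Formula.realize_relabel, this, hp]
  obtain ⟨M, v, hv⟩ := exists_realize_of_finitely_realized (T := T) (Set.range γ) (by
    intro Γ₀ hΓ₀
    obtain ⟨P, -, rfl⟩ := Finset.subset_set_image_iff.1 (Set.image_univ ▸ hΓ₀)
    let S : Finset I := P.image Prod.fst ∪ P.image Prod.snd
    -- Ranks within `S` embed the finitely many indices in play into a finite ladder.
    let r : I → ℕ := fun i => (S.filter (· < i)).card
    have hr : ∀ i ∈ S, ∀ j ∈ S, r i < r j ↔ i < j := by
      have hlt : ∀ i ∈ S, ∀ j, i < j → r i < r j := fun i hi j hij =>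
        Finset.card_lt_card (Finset.ssubset_iff_subset_ne.2 ⟨fun x hx => by
          simp only [Finset.mem_filter] at hx ⊢; exact ⟨hx.1, hx.2.trans hij⟩, fun he => by
          have : i ∈ S.filter (· < j) := Finset.mem_filter.2 ⟨hi, hij⟩
          rw [← he] at this
          exact lt_irrefl _ (Finset.mem_filter.1 this).2⟩)
      intro i hi j hj
      refine ⟨fun h => ?_, hlt i hi j⟩
      by_contra hij
      rcases (not_lt.1 hij).eq_or_lt with rfl | hji
      · exact lt_irrefl _ h
      · exact lt_asymm h (hlt j hj i hji)
    have hrS : ∀ i, r i < S.card + 1 := fun i =>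
      Nat.lt_succ_of_le (Finset.card_le_card (Finset.filter_subset _ _))
    obtain ⟨M, a, b, hab⟩ := h (S.card + 1)
    refine ⟨M, Sum.elim (fun x => a (r x.1) x.2) (fun y => b (r y.1) y.2), fun ψ hψ => ?_⟩
    obtain ⟨p, hp, rfl⟩ := Finset.mem_image.1 hψ
    have hp₁ : p.1 ∈ S := Finset.mem_union_left _ (Finset.mem_image_of_mem _ hp)
    have hp₂ : p.2 ∈ S := Finset.mem_union_right _ (Finset.mem_image_of_mem _ hp)
    rw [hγ, ← hr _ hp₁ _ hp₂]
    exact hab _ (hrS _) _ (hrS _))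
  exact ⟨M, fun i x => v (Sum.inl (i, x)), fun j y => v (Sum.inr (j, y)),
    fun i j => (hγ M v (i, j)).1 (hv _ ⟨_, rfl⟩)⟩

theorem HasLadders.hasOrderProperty {m n : ℕ} {φ : L.Formula (Fin m ⊕ Fin n)}
    (h : HasLadders T φ) : HasOrderProperty T φ :=
  h.exists_ladder ℕ

/-- Renaming the variables on the right-hand side preserves ladders. -/
theorem HasLadders.relabel {α β β' : Type} {φ : L.Formula (α ⊕ β)} (h : HasLadders T φ)
    (e : β ≃ β') : HasLadders T (φ.relabel (Sum.map id e)) := by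
  intro K
  obtain ⟨M, a, b, hab⟩ := h K
  refine ⟨M, a, fun j => b j ∘ e.symm, fun i hi j hj => ?_⟩
  rw [← hab i hi j hj]
  dsimp only
  rw [Formula.realize_relabel, iff_iff_eq]
  congr 1
  ext z
  cases z <;> simp

end Compactness

/-! ### Reduction of stability to one variable -/

section OneVariable

open FirstOrder FirstOrder.Language

variable {L : FirstOrder.Language.{u, v}} {T : L.Theory} {m n : ℕ}

/-- `φ(x₀, x; y)` as a partitioned formula in `x` and `x₀, y`. -/
def moveVar (φ : L.Formula (Fin (m + 1) ⊕ Fin n)) : L.Formula (Fin m ⊕ Fin (n + 1)) :=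
  φ.relabel (Sum.elim (Fin.cases (Sum.inr 0) Sum.inl) (Sum.inr ∘ Fin.succ))

theorem realize_moveVar {M : Type w} [L.Structure M] (φ : L.Formula (Fin (m + 1) ⊕ Fin n))
    (x₀ : M) (x : Fin m → M) (y : Fin n → M) :
    (moveVar φ).Realize (Sum.elim x (Fin.cons x₀ y : Fin (n + 1) → M)) ↔
      φ.Realize (Sum.elim (Fin.cons x₀ x : Fin (m + 1) → M) y) := by
  rw [moveVar, Formula.realize_relabel, iff_iff_eq]
  congr 1
  ext z
  rcases z with z | z
  · refine Fin.cases ?_ (fun z => ?_) z <;> simp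
  · simp

/-- The formula saying of `x₀` and `y₀, …, y_{N - 1}` that some `x` satisfies
`φ(x₀, x; yₖ)` exactly for `k ≥ s`. -/
noncomputable def cutFormula (φ : L.Formula (Fin (m + 1) ⊕ Fin n)) {N : ℕ} (s : Fin (N + 1)) :
    L.Formula (Fin 1 ⊕ Fin N × Fin n) :=
  let ψ : Fin N → L.Formula ((Fin 1 ⊕ Fin N × Fin n) ⊕ Fin m) := fun k =>
    φ.relabel (Sum.elim (Fin.cases (Sum.inl (Sum.inl 0)) Sum.inr) fun y => Sum.inl (Sum.inr (k, y)))
  Formula.iExs (Fin m) (Formula.iInf fun k => if s ≤ k.castSucc then ψ k else ∼(ψ k))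

theorem realize_cutFormula {M : Type w} [L.Structure M] (φ : L.Formula (Fin (m + 1) ⊕ Fin n))
    {N : ℕ} (s : Fin (N + 1)) (x : Fin 1 → M) (y : Fin N × Fin n → M) :
    (cutFormula φ s).Realize (Sum.elim x y) ↔ ∃ z : Fin m → M, ∀ k,
      φ.Realize (Sum.elim (Fin.cons (x 0) z : Fin (m + 1) → M) fun t => y (k, t)) ↔
        s ≤ k.castSucc := by
  rw [cutFormula, Formula.realize_iExs]
  refine exists_congr fun z => ?_
  rw [Formula.realize_iInf]
  refine forall_congr' fun k => ?_
  have : (Sum.elim (Sum.elim x y) z) ∘ (Sum.elim (Fin.cases (Sum.inl (Sum.inl 0)) Sum.inr)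
      fun t => Sum.inl (Sum.inr (k, t)) : Fin (m + 1) ⊕ Fin n → _) =
      Sum.elim (Fin.cons (x 0) z : Fin (m + 1) → M) fun t => y (k, t) := by
    ext t
    rcases t with t | t
    · refine Fin.cases ?_ (fun t => ?_) t <;> simp
    · simp
  split_ifs with hs
  · simp [Formula.realize_relabel, this, hs]
  · simp [Formula.realize_relabel, this, hs]

theorem HasOrderProperty.moveVar (hT : ∀ n (φ : L.Formula (Fin 1 ⊕ Fin n)), IsStableFormula T φ)
    {φ : L.Formula (Fin (m + 1) ⊕ Fin n)} (h : HasOrderProperty T φ) :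
    HasOrderProperty T (moveVar φ) := by
  refine HasLadders.hasOrderProperty fun N => ?_
  obtain ⟨M, a, b, hab⟩ := h
  -- The original ladder realizes the cut at `s` with a first coordinate depending on `s`; stability
  -- of the cut formulas gives a common one.
  let Θ : Fin (N + 1) → (Fin 1 → M) → (Fin N → Fin n → M) → Prop := fun s x y =>
    (cutFormula φ s).Realize (Sum.elim x fun p => y p.1 p.2)
  obtain ⟨x, y, hxy⟩ := exists_forall_of_forall_diagonal Θ (by
    intro s
    by_contra! hK
    have : HasLadders T (cutFormula φ s) := fun K => by
      obtain ⟨a', b', h'⟩ := hK K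
      exact ⟨M, a', fun j p => b' j p.1 p.2, h'⟩
    exact hT _ _ (this.relabel finProdFinEquiv).hasOrderProperty) (fun i _ => a i 0) b (by
    intro s e he
    refine (realize_cutFormula φ s _ _).2 ⟨Fin.tail (a (e s)), fun k => ?_⟩
    rw [Fin.cons_self_tail, ← Fin.lt_succAbove_iff_le_castSucc, ← he.lt_iff_lt]
    exact hab (e s) (e (s.succAbove k)))
  choose z hz using fun s => (realize_cutFormula φ s _ _).1 (hxy s)
  -- Row `i` uses the cut at `i + 1`, because `i + 1 ≤ j` means `i < j`. Values from `N` on are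
  -- irrelevant.
  refine ⟨M, fun i => z (Fin.ofNat (N + 1) (i + 1)), fun j => Fin.cons (x 0)
    (if hj : j < N then y ⟨j, hj⟩ else fun _ => x 0), fun i hi j hj => ?_⟩
  dsimp only
  rw [realize_moveVar, dif_pos hj, hz _ ⟨j, hj⟩]
  simp only [Fin.le_def, Fin.val_castSucc, Fin.val_ofNat]
  rw [Nat.mod_eq_of_lt (by omega)]
  exact Nat.succ_le_iff

theorem not_hasOrderProperty_zero (φ : L.Formula (Fin 0 ⊕ Fin n)) : ¬HasOrderProperty T φ := by
  rintro ⟨M, a, b, h⟩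
  have h₀ := (h 0 1).2 Nat.zero_lt_one
  rw [Subsingleton.elim (a 0) (a 1)] at h₀
  exact lt_irrefl 1 ((h 1 1).1 h₀)

/-- A theory is stable if all formulas in a single variable are stable. -/
theorem isStable_of_forall_one_variable
    (hT : ∀ n (φ : L.Formula (Fin 1 ⊕ Fin n)), IsStableFormula T φ) : IsStable T := by
  intro m
  induction m with
  | zero => exact fun n φ => not_hasOrderProperty_zero φ
  | succ m ih => exact fun n φ h => ih _ _ (h.moveVar hT)

end OneVariable

/-! ### Unstable formulas of independence dimension at most one -/

section IndepDim

open FirstOrder FirstOrder.Language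

theorem independent_pair {X : Type w} {A B : Set X} [DecidableEq (Set X)]
    (h₁ : (A ∩ B).Nonempty) (h₂ : (A ∩ Bᶜ).Nonempty) (h₃ : (Aᶜ ∩ B).Nonempty)
    (h₄ : (Aᶜ ∩ Bᶜ).Nonempty) : Independent (({A, B} : Finset (Set X)) : Set (Set X)) := by
  intro s
  have hA : A ∈ (({A, B} : Finset (Set X)) : Set (Set X)) := by simp
  have hB : B ∈ (({A, B} : Finset (Set X)) : Set (Set X)) := by simp
  have key : ((bif s ⟨A, hA⟩ then A else Aᶜ) ∩ (bif s ⟨B, hB⟩ then B else Bᶜ)).Nonempty := by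
    cases s ⟨A, hA⟩ <;> cases s ⟨B, hB⟩ <;> assumption
  obtain ⟨x, hxA, hxB⟩ := key
  refine ⟨x, Set.mem_iInter.2 ?_⟩
  rintro ⟨C, hC⟩
  have : C = A ∨ C = B := by simpa using hC
  rcases this with rfl | rfl <;> assumption

variable {L : FirstOrder.Language.{u, v}} {T : L.Theory} {m n : ℕ}

/-- The points `a` and `e` fill two of the four Boolean cells of the two instances; failure of both
inclusions would fill the other two. -/
theorem IndepDimLE.paramLE_total {φ : L.Formula (Fin m ⊕ Fin n)} (h : IndepDimLE T φ 1)
    (M : Theory.ModelType.{u, v, max u v} T) {b c : Fin n → M} {a e : Fin m → M}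
    (hab : φ.Realize (Sum.elim a b)) (hac : φ.Realize (Sum.elim a c))
    (heb : ¬φ.Realize (Sum.elim e b)) (hec : ¬φ.Realize (Sum.elim e c)) :
    ParamLE M φ b c ∨ ParamLE M φ c b := by
  classical
  by_contra! hne
  obtain ⟨N, hN, hdim⟩ := h
  simp only [ParamLE, not_forall] at hne
  obtain ⟨⟨x, hxb, hxc⟩, y, hyc, hyb⟩ := hne
  have hbc : inst M φ b ≠ inst M φ c := fun he => hxc (he ▸ hxb : x ∈ inst M φ c)
  have : 2 ≤ N := (hdim M).2 ⟨{inst M φ b, inst M φ c}, by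
    simp [Set.insert_subset_iff], Finset.card_pair hbc,
    independent_pair ⟨a, hab, hac⟩ ⟨x, hxb, hxc⟩ ⟨y, hyb, hyc⟩ ⟨e, heb, hec⟩⟩
  omega

theorem inducesInfiniteLinearOrder_of_total {M : Type w} [L.Structure M]
    {φ : L.Formula (Fin m ⊕ Fin n)} {D : Set (Fin n → M)}
    (htotal : ∀ b ∈ D, ∀ c ∈ D, ParamLE M φ b c ∨ ParamLE M φ c b)
    (b : ℕ → Fin n → M) (hbD : ∀ i, b i ∈ D) (hb : StrictMono fun i => inst M φ (b i)) :
    InducesInfiniteLinearOrder M φ D := by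
  classical
  refine ⟨Infinite.of_injective
    (fun i : ℕ => (Quotient.mk _ ⟨b i, hbD i⟩ : Quotient (paramSetoid M φ D))) ?_, ?_⟩
  · intro i j hij
    obtain ⟨h₁, h₂⟩ := Quotient.exact hij
    exact hb.injective (Set.Subset.antisymm h₁ h₂)
  · let le : Quotient (paramSetoid M φ D) → Quotient (paramSetoid M φ D) → Prop :=
      Quotient.lift₂ (fun b c => ParamLE M φ b c) fun b₁ c₁ b₂ c₂ hb hc => propext
        ⟨fun h a ha => hc.1 a (h a (hb.2 a ha)), fun h a ha => hc.2 a (h a (hb.1 a ha))⟩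
    exact ⟨{
      le := le
      le_refl := fun x => Quotient.inductionOn x fun _ _ h => h
      le_trans := fun x y z => Quotient.inductionOn₃ x y z fun _ _ _ h h' a ha => h' a (h a ha)
      le_antisymm := fun x y => Quotient.inductionOn₂ x y fun _ _ h h' => Quotient.sound ⟨h, h'⟩
      le_total := fun x y => Quotient.inductionOn₂ x y fun b c => htotal b b.2 c c.2
      toDecidableLE := Classical.decRel _ }, fun _ _ => Iff.rfl⟩

theorem definable_setOf_realize {M : Type w} [L.Structure M] (φ : L.Formula (Fin m ⊕ Fin n))
    (a : Fin m → M) :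
    (Set.univ : Set M).Definable L {b : Fin n → M | φ.Realize (Sum.elim a b)} := by
  have h : (Set.univ : Set M).Definable L {p : Fin m ⊕ Fin n → M | φ.Realize p} :=
    (Set.empty_definable_iff.2 ⟨φ, rfl⟩).mono (Set.empty_subset _)
  rw [Set.definable_iff_exists_formula_sum] at h ⊢
  obtain ⟨ψ, hψ⟩ := h
  refine ⟨ψ.relabel (Sum.elim Sum.inl (Sum.elim (fun i => Sum.inl ⟨a i, trivial⟩) Sum.inr)), ?_⟩
  ext b
  have hb := Set.ext_iff.1 hψ (Sum.elim a b)
  simp only [Set.mem_ofPred_eq] at hb ⊢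
  rw [hb, Formula.realize_relabel, iff_iff_eq]
  congr 1
  ext z
  rcases z with z | z | z <;> simp

theorem IndepDimLE.strictOrder_and_linearOrder {φ : L.Formula (Fin m ⊕ Fin n)}
    (h : IndepDimLE T φ 1) (hφ : HasOrderProperty T φ) :
    HasStrictOrderProperty T φ ∧
      ∃ (M : Theory.ModelType.{u, v, max u v} T) (D : Set (Fin n → M)),
        (Set.univ : Set M).Definable L D ∧ InducesInfiniteLinearOrder M φ D := by
  -- The index `⊤` supplies a point outside every instance of the ladder.
  obtain ⟨M, a, b, hab⟩ := hφ.hasLadders.exists_ladder (WithTop ℕ)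
  let D : Set (Fin n → M) :=
    {y | φ.Realize (Sum.elim (a 0) y)} ∩ {y | φ.Realize (Sum.elim (a ⊤) y)}ᶜ
  -- The shift drops `b 0`, whose instance does not contain `a 0`.
  let b' : ℕ → Fin n → M := fun i => b ((i + 1 : ℕ) : WithTop ℕ)
  have hb'D : ∀ i, b' i ∈ D := fun i =>
    ⟨(hab _ _).2 (by exact_mod_cast Nat.succ_pos i), fun he => not_top_lt ((hab _ _).1 he)⟩
  have htotal : ∀ x ∈ D, ∀ y ∈ D, ParamLE M φ x y ∨ ParamLE M φ y x :=
    fun x hx y hy => h.paramLE_total M hx.1 hy.1 hx.2 hy.2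
  have hmono : StrictMono fun i => inst M φ (b' i) := by
    intro i j hij
    have hij' : ((i + 1 : ℕ) : WithTop ℕ) < ((j + 1 : ℕ) : WithTop ℕ) := by
      exact_mod_cast Nat.succ_lt_succ hij
    have hnot : ¬ParamLE M φ (b' j) (b' i) := fun hle =>
      lt_irrefl _ ((hab _ _).1 (hle (a ((i + 1 : ℕ) : WithTop ℕ)) ((hab _ _).2 hij')))
    exact ⟨(htotal _ (hb'D i) _ (hb'D j)).resolve_right hnot, hnot⟩
  exact ⟨⟨M, b', hmono⟩, M, D,
    (definable_setOf_realize φ _).inter (definable_setOf_realize φ _).compl,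
    inducesInfiniteLinearOrder_of_total htotal b' hb'D hmono⟩

theorem definable_paramLE (M : Type w) [L.Structure M] (φ : L.Formula (Fin m ⊕ Fin n)) :
    (Set.univ : Set M).Definable L
      {p : Fin n ⊕ Fin n → M | ParamLE M φ (p ∘ Sum.inl) (p ∘ Sum.inr)} := by
  refine Set.Definable.mono (A := ∅) (Set.empty_definable_iff.2
    ⟨Formula.iAlls (Fin m) ((φ.relabel (Sum.elim Sum.inr (Sum.inl ∘ Sum.inl))).imp
      (φ.relabel (Sum.elim Sum.inr (Sum.inl ∘ Sum.inr)))), ?_⟩) (Set.empty_subset _)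
  ext p
  simp only [Set.mem_ofPred_eq, Formula.realize_iAlls, Formula.realize_imp,
    Formula.realize_relabel, ParamLE]
  have : ∀ (x : Fin m → M) (f : Fin n → Fin n ⊕ Fin n),
      (fun t => Sum.elim p x t) ∘ (Sum.elim Sum.inr (Sum.inl ∘ f) : Fin m ⊕ Fin n → _) =
        Sum.elim x (p ∘ f) := by
    intro x f
    ext t
    cases t <;> rfl
  simp only [this]

theorem interpretsInfiniteLinearOrder_of_induces (M : Theory.ModelType.{u, v, max u v} T)
    {φ : L.Formula (Fin m ⊕ Fin n)} {D : Set (Fin n → M)}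
    (hD : (Set.univ : Set M).Definable L D) (h : InducesInfiniteLinearOrder M φ D) :
    InterpretsInfiniteLinearOrder T := by
  obtain ⟨hinf, lo, hlo⟩ := h
  refine ⟨M, Quotient (paramSetoid M φ D), lo, hinf, n, D, Quotient.mk _, hD,
    Quotient.mk_surjective, ?_, ?_⟩
  · convert ((hD.preimage_comp (Sum.inl : Fin n → Fin n ⊕ Fin n)).inter
      (hD.preimage_comp (Sum.inr : Fin n → Fin n ⊕ Fin n))).inter ((definable_paramLE M φ).inter
      ((definable_paramLE M φ).preimage_comp Sum.swap)) using 1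
    ext p
    constructor
    · rintro ⟨h₁, h₂, h₃⟩
      exact ⟨⟨h₁, h₂⟩, Quotient.exact h₃⟩
    · rintro ⟨⟨h₁, h₂⟩, h₃⟩
      exact ⟨h₁, h₂, Quotient.sound h₃⟩
  · convert ((hD.preimage_comp (Sum.inl : Fin n → Fin n ⊕ Fin n)).inter
      (hD.preimage_comp (Sum.inr : Fin n → Fin n ⊕ Fin n))).inter (definable_paramLE M φ) using 1
    ext p
    constructor
    · rintro ⟨h₁, h₂, h₃⟩
      exact ⟨⟨h₁, h₂⟩, (hlo _ _).1 h₃⟩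
    · rintro ⟨⟨h₁, h₂⟩, h₃⟩
      exact ⟨h₁, h₂, (hlo _ _).2 h₃⟩

end IndepDim

/-! ### Weakly VC-minimal theories -/

section WeaklyVCMinimal

open FirstOrder FirstOrder.Language

variable {L : FirstOrder.Language.{u, v}} {T : L.Theory} {m n : ℕ}

theorem mem_iff_mem_of_mem_closure {X : Type w} {𝒮 : Set (Set X)} {A : Set X}
    (hA : A ∈ BooleanSubalgebra.closure 𝒮) {x y : X} (h : ∀ B ∈ 𝒮, x ∈ B ↔ y ∈ B) :
    x ∈ A ↔ y ∈ A := by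
  induction hA using BooleanSubalgebra.closure_bot_sup_induction with
  | mem B hB => exact h B hB
  | bot => exact Iff.rfl
  | sup B _ C _ hB hC => exact or_congr hB hC
  | compl B _ hB => exact not_congr hB

/-- The formula saying of `y` that there are `zᵢ` such that `φ(x; y)` depends on the truth values
of the `ψᵢ(x; zᵢ)` only. -/
noncomputable def determinedFormula (φ : L.Formula (Fin m ⊕ Fin n)) {k : ℕ} {l : Fin k → ℕ}
    (ψ : (i : Fin k) → L.Formula (Fin m ⊕ Fin (l i))) : L.Formula (Fin n) :=
  let iffAt {t : ℕ} (χ : L.Formula (Fin m ⊕ Fin t))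
      (f : Fin t → (Fin n ⊕ (Σ i, Fin (l i))) ⊕ (Fin m ⊕ Fin m)) :
      L.Formula ((Fin n ⊕ (Σ i, Fin (l i))) ⊕ (Fin m ⊕ Fin m)) :=
    (χ.relabel (Sum.elim (Sum.inr ∘ Sum.inl) f)).iff (χ.relabel (Sum.elim (Sum.inr ∘ Sum.inr) f))
  Formula.iExs (Σ i, Fin (l i)) (Formula.iAlls (Fin m ⊕ Fin m)
    ((Formula.iInf fun i => iffAt (ψ i) fun z => Sum.inl (Sum.inr ⟨i, z⟩)).imp
      (iffAt φ (Sum.inl ∘ Sum.inl))))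

theorem realize_determinedFormula {M : Type w} [L.Structure M] (φ : L.Formula (Fin m ⊕ Fin n))
    {k : ℕ} {l : Fin k → ℕ} (ψ : (i : Fin k) → L.Formula (Fin m ⊕ Fin (l i))) (b : Fin n → M) :
    (determinedFormula φ ψ).Realize b ↔ ∃ c : (i : Fin k) → Fin (l i) → M,
      ∀ x x' : Fin m → M,
        (∀ i, (ψ i).Realize (Sum.elim x (c i)) ↔ (ψ i).Realize (Sum.elim x' (c i))) →
          (φ.Realize (Sum.elim x b) ↔ φ.Realize (Sum.elim x' b)) := by
  have key : ∀ {t : ℕ} (c : (Σ i, Fin (l i)) → M) (x : Fin m ⊕ Fin m → M)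
      (g : Fin m → Fin m ⊕ Fin m) (f : Fin t → Fin n ⊕ (Σ i, Fin (l i))),
      (fun z => Sum.elim (Sum.elim b c) x z) ∘
        (Sum.elim (Sum.inr ∘ g) (Sum.inl ∘ f) : Fin m ⊕ Fin t → _) =
      Sum.elim (x ∘ g) (Sum.elim b c ∘ f) := by
    intro t c x g f
    ext z
    cases z <;> rfl
  simp only [determinedFormula, Formula.realize_iExs, Formula.realize_iAlls, Formula.realize_imp,
    Formula.realize_iInf, Formula.realize_iff, Formula.realize_relabel]
  constructor
  · rintro ⟨c, hc⟩
    refine ⟨fun i z => c ⟨i, z⟩, fun x x' h => ?_⟩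
    have := hc (Sum.elim x x')
    rw [key c _ _ Sum.inl, key c _ _ Sum.inl] at this
    refine this fun i => ?_
    erw [key c _ _ fun z => Sum.inr ⟨i, z⟩, key c _ _ fun z => Sum.inr ⟨i, z⟩]
    exact h i
  · rintro ⟨c, hc⟩
    refine ⟨fun p => c p.1 p.2, fun x h => ?_⟩
    rw [key _ _ _ Sum.inl, key _ _ _ Sum.inl]
    refine hc (x ∘ Sum.inl) (x ∘ Sum.inr) fun i => ?_
    have := h i
    erw [key _ _ _ fun z => Sum.inr ⟨i, z⟩, key _ _ _ fun z => Sum.inr ⟨i, z⟩] at this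
    exact this

/-- In a weakly VC-minimal theory, an unstable formula in one variable gives rise to an unstable
formula of independence dimension at most one. -/
theorem IsWeaklyVCMinimal.exists_unstable (hT : IsWeaklyVCMinimal T)
    {φ : L.Formula (Fin 1 ⊕ Fin n)} (hφ : HasOrderProperty T φ) :
    ∃ (l : ℕ) (ψ : L.Formula (Fin 1 ⊕ Fin l)), IndepDimLE T ψ 1 ∧ HasOrderProperty T ψ := by
  by_contra! hstable
  -- `Γ` describes a parameter for which no list of formulas of dimension at most one determines
  -- `φ`. Weak VC-minimality excludes it, although the list may depend on the parameter.
  let Γ : Set (L.Formula (Fin n)) := {γ | ∃ (k : ℕ) (l : Fin k → ℕ)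
    (ψ : (i : Fin k) → L.Formula (Fin 1 ⊕ Fin (l i))),
      (∀ i, IndepDimLE T (ψ i) 1) ∧ γ = ∼(determinedFormula φ ψ)}
  obtain ⟨M, b, hb⟩ := exists_realize_of_finitely_realized (T := T) Γ (by
    intro Γ₀ hΓ₀
    obtain ⟨M, a, b, hab⟩ := hφ
    by_contra! hno
    choose F hF hFb using fun j => hno M (b j)
    -- Every `b j` violates a member of the finite set `Γ₀`, so a single list `ψ` serves infinitely
    -- many `j`.
    obtain ⟨γ, hγ⟩ := Finite.exists_infinite_fiber fun j => (⟨F j, hF j⟩ : Γ₀)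
    obtain ⟨k, l, ψ, hψ, hγψ⟩ := hΓ₀ γ.2
    let S : Set ℕ := (fun j => (⟨F j, hF j⟩ : Γ₀)) ⁻¹' {γ}
    have hS : S.Infinite := Set.infinite_coe_iff.1 hγ
    have hdet : ∀ j ∈ S, (determinedFormula φ ψ).Realize (b j) := fun j hj => by
      have h := hFb j
      rw [show F j = γ from congrArg Subtype.val hj, hγψ, Formula.realize_not, not_not] at h
      exact h
    let g := Nat.nth (· ∈ S)
    have hg : StrictMono g := Nat.nth_strictMono hS
    choose c hc using fun j =>
      (realize_determinedFormula φ ψ _).1 (hdet (g j) (Nat.nth_mem_of_infinite hS j))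
    obtain ⟨i, hi⟩ := exists_hasLadder_of_determines
      (fun i (x : Fin 1 → M) (z : Fin (l i) → M) => (ψ i).Realize (Sum.elim x z))
      (fun j => a (g j)) (fun i j => c j i) (by
        intro i i' j h
        have := hc j _ _ h
        rwa [hab, hab, hg.lt_iff_lt, hg.lt_iff_lt] at this)
    exact hstable _ _ (hψ i) (HasLadders.hasOrderProperty fun K => ⟨M, hi K⟩))
  obtain ⟨k, l, ψ, c, hψ, hmem⟩ := hT n φ M b
  refine (Formula.realize_not.1 (hb _ ⟨k, l, ψ, hψ, rfl⟩))
    ((realize_determinedFormula φ ψ b).2 ⟨c, fun x x' h => ?_⟩)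
  refine mem_iff_mem_of_mem_closure hmem ?_
  rintro _ ⟨i, rfl⟩
  exact h i

end WeaklyVCMinimal

end WeakVC

theorem mainTheorem3 {L : FirstOrder.Language.{u, v}} (T : L.Theory) (hT : T.IsComplete) :
    (WeakVC.IsWeaklyVCMinimal T →
      WeakVC.IsStable T ∨ WeakVC.InterpretsInfiniteLinearOrder T) ∧
    (∀ (m n : ℕ) (φ : L.Formula (Fin m ⊕ Fin n)),
      WeakVC.IndepDimLE T φ 1 → ¬ WeakVC.IsStableFormula T φ →
        WeakVC.HasStrictOrderProperty T φ ∧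
        ∃ (M : FirstOrder.Language.Theory.ModelType.{u, v, max u v} T) (D : Set (Fin n → M)),
          (Set.univ : Set M).Definable L D ∧ WeakVC.InducesInfiniteLinearOrder M φ D) := by
  refine ⟨fun hVC => or_iff_not_imp_left.2 fun hunst => ?_,
    fun m n φ hdim hφ => hdim.strictOrder_and_linearOrder (not_not.1 hφ)⟩
  have hone : ∃ (n : ℕ) (φ : L.Formula (Fin 1 ⊕ Fin n)), WeakVC.HasOrderProperty T φ := by
    by_contra! h
    exact hunst (WeakVC.isStable_of_forall_one_variable h)
  obtain ⟨n, φ, hφ⟩ := hone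
  obtain ⟨l, ψ, hψ, hψ'⟩ := hVC.exists_unstable hφ
  obtain ⟨-, M, D, hD, hind⟩ := hψ.strictOrder_and_linearOrder hψ'
  exact WeakVC.interpretsInfiniteLinearOrder_of_induces M hD hind
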